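/- Let $\mathcal T$ be either the category of non-empty topological spaces and continuous maps (with free homotopies), or the category of well-pointed spaces (the inclusion of the basepoint is a closed cofibration) and basepoint-preserving maps (with pointed homotopies). A \emph{sectional category} on $\mathcal T$ is an assignment of a value $\mathrm{secat}(\iota)\in\mathbb N\cup\{\infty\}$ to every map $\iota\colon A\to Y$ of $\mathcal T$ such that (S0) $\mathrm{secat}(\iota)=0$ if and only if there is a map $s\colon Y\to A$ with $\iota\circ s\simeq \mathrm{id}_Y$; (S1) if $\iota\colon A\to X$, $\kappa\colon B\to X$, $\zeta\colon B\to A$ satisfy $\iota\circ\zeta\simeq\kappa$, then $\mathrm{secat}(\iota)\le\mathrm{secat}(\kappa)$; (S2) if a square with sides $q\colon P\to X$, $p\colon P\to A$, $f\colon X\to Y$, $\iota\colon A\to Y$ is a homotopy pullback in $\mathcal T$, then $\mathrm{secat}(q)\le \mathrm{secat}(\iota)$. Given such a $\mathrm{secat}$, the lifting category of $f\colon X\to Y$ and $\iota\colon A\to Y$ is $\mathrm{liftcat}_f(\iota)=\mathrm{secat}(q)$, where $q\colon P\to X$ belongs to any homotopy pullback $P$ of $f$ and $\iota$ in $\mathcal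 T$ (and $\infty$ if there is none in $\mathcal T$). With $\Delta\colon Y\to Y\times Y$ the diagonal, put $D(f,g)=\mathrm{liftcat}_{(f,g)}(\Delta)$ for $f,g\colon X\to Y$, $\mathrm{TC}(Y)=\mathrm{secat}(\Delta)$, and, for $Y$ path-connected, $\mathrm{cat}(Y)=\mathrm{liftcat}_{\mathrm{id}_Y}(c)$ for any constant map $c\colon *\to Y$ (in the pointed setting $c$ is the inclusion of the basepoint, and path-connectedness is not needed). Let $X$ be a space of $\mathcal T$, path-connected in the unpointed setting, and let $n_X\colon X\to X$ be a constant map of $\mathcal T$. Then, for every sectional category on $\mathcal T$ and every choice of the constant maps that define $\mathrm{cat}(X)$ and $\mathrm{cat}(X\times X)$, $$D(\mathrm{id}_X,n_X)=\mathrm{cat}(X)\le \mathrm{TC}(X)\le \mathrm{cat}(X\times X).$$ The same holds for the open-cover versions of these invariants, in which $\mathrm{liftcat}_f(\iota)$ is the least $n$ such that $X$ has an open cover $U_0,\dots,U_n$ (each $U_i$ containing the basepoint in the pointed setting) with maps $l_i\colon U_i\to A$ of $\mathcal T$ satisfying $\iota\circ l_i\simeq f|_{U_i}$ for all $i$ (and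 $\infty$ if there is no such $n$), and $\mathrm{secat}(\iota)=\mathrm{liftcat}_{\mathrm{id}_Y}(\iota)$. -/

import Mathlib

open scoped unitInterval

universe u

/-! ### The unpointed setting: non-empty topological spaces and continuous maps -/

namespace UnptLift

section HomotopyPullback

variable {P X A Y : Type u} [TopologicalSpace P] [TopologicalSpace X] [TopologicalSpace A]
  [TopologicalSpace Y]

/-- The standard homotopy pullback of `f : X → Y` and `ι : A → Y`: triples `(x, γ, a)` where `γ` is
a path in `Y` from `f x` to `ι a`, with the compact-open topology on paths. -/
abbrev StdPullback (f : C(X, Y)) (ι : C(A, Y)) : Type u :=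
  {w : X × C(I, Y) × A // w.2.1 0 = f w.1 ∧ w.2.1 1 = ι w.2.2}

/-- The square with sides `q : P → X`, `p : P → A`, `f : X → Y`, `ι : A → Y` is a homotopy pullback:
it commutes up to some homotopy `f ∘ q ≃ ι ∘ p` such that the induced map `w` from `P` to the
standard homotopy pullback is a homotopy equivalence. (A map `w` whose outer coordinates are `q`
and `p` is the same thing as such a homotopy, namely its path coordinate.) -/
def IsHomotopyPullback (q : C(P, X)) (p : C(P, A)) (f : C(X, Y)) (ι : C(A, Y)) : Prop :=
  ∃ w : C(P, StdPullback f ι),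
    (∀ z, (w z).1.1 = q z) ∧ (∀ z, (w z).1.2.2 = p z) ∧
    ∃ v : C(StdPullback f ι, P),
      (v.comp w).Homotopic (ContinuousMap.id P) ∧
      (w.comp v).Homotopic (ContinuousMap.id (StdPullback f ι))

end HomotopyPullback

/-- An abstract sectional category: an integer or `∞` attached to every continuous map between
non-empty spaces, subject to the three axioms S0, S1, S2. (Its values on maps from or to an empty
space are unconstrained and never used.) -/
structure SectionalCategory where
  /-- the sectional category of a map -/
  secat : ∀ {A Y : Type u} [TopologicalSpace A] [TopologicalSpace Y], C(A, Y) → ℕ∞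
  /-- S0: `secat ι = 0` iff `ι` has a homotopy section. -/
  S0 : ∀ {A Y : Type u} [TopologicalSpace A] [TopologicalSpace Y] [Nonempty A] [Nonempty Y]
    (ι : C(A, Y)),
    secat ι = 0 ↔ ∃ s : C(Y, A), (ι.comp s).Homotopic (ContinuousMap.id Y)
  /-- S1: if `κ ≃ ι ∘ ζ` then `secat ι ≤ secat κ`. -/
  S1 : ∀ {A B X : Type u} [TopologicalSpace A] [TopologicalSpace B] [TopologicalSpace X]
    [Nonempty A] [Nonempty B] [Nonempty X] (ι : C(A, X)) (κ : C(B, X)) (ζ : C(B, A)),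
    (ι.comp ζ).Homotopic κ → secat ι ≤ secat κ
  /-- S2: `secat` does not increase under homotopy pullback. -/
  S2 : ∀ {P X A Y : Type u} [TopologicalSpace P] [TopologicalSpace X] [TopologicalSpace A]
    [TopologicalSpace Y] [Nonempty P] [Nonempty X] [Nonempty A] [Nonempty Y]
    (q : C(P, X)) (p : C(P, A)) (f : C(X, Y)) (ι : C(A, Y)),
    IsHomotopyPullback q p f ι → secat q ≤ secat ι

variable {X Y A : Type u} [TopologicalSpace X] [TopologicalSpace Y] [TopologicalSpace A]

/-- The diagonal map. -/
def diag (Y : Type u) [TopologicalSpace Y] : C(Y, Y × Y) :=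
  (ContinuousMap.id Y).prodMk (ContinuousMap.id Y)

/-- The constant map `* → Y` with value `y₀`. -/
def pointMap (y₀ : Y) : C(PUnit.{u + 1}, Y) := ContinuousMap.const _ y₀

namespace SectionalCategory

variable (S : SectionalCategory.{u})

/-- The lifting category from `f` to `ι`: the sectional category of `q : P → X`, where `P` is a
homotopy pullback of `f` and `ι`. By S1 all choices of `P` give the same value, so the set
below has at most one element; it is empty, and the value is `∞`, only if the homotopy pullback
is the empty space. -/
noncomputable def liftcat (f : C(X, Y)) (ι : C(A, Y)) : ℕ∞ :=
  sInf {m | ∃ (P : Type u) (_ : TopologicalSpace P) (_ : Nonempty P) (q : C(P, X)) (p : C(P, A)),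
    IsHomotopyPullback q p f ι ∧ S.secat q = m}

/-- The homotopic distance `D(f, g)`. -/
noncomputable def dist (f g : C(X, Y)) : ℕ∞ := S.liftcat (f.prodMk g) (diag Y)

/-- The topological complexity. -/
noncomputable def TC (Y : Type u) [TopologicalSpace Y] : ℕ∞ := S.secat (diag Y)

/-- The category of a map `f : X → Y`, computed with the constant map `* → Y` at `y₀`. -/
noncomputable def catMap (f : C(X, Y)) (y₀ : Y) : ℕ∞ := S.liftcat f (pointMap y₀)

/-- The LS category of `Y`, computed with the constant map `* → Y` at `y₀`. -/
noncomputable def cat (Y : Type u) [TopologicalSpace Y] (y₀ : Y) : ℕ∞ :=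
  S.catMap (ContinuousMap.id Y) y₀

end SectionalCategory

/-! The version with open covers. -/

/-- There is a categorical open cover of `X` by `n + 1` open sets for `f` and `ι`. -/
def HasCatCover (f : C(X, Y)) (ι : C(A, Y)) (n : ℕ) : Prop :=
  ∃ U : Fin (n + 1) → Set X, (∀ i, IsOpen (U i)) ∧ (∀ x, ∃ i, x ∈ U i) ∧
    ∀ i, ∃ l : C(U i, A), (ι.comp l).Homotopic (f.restrict (U i))

/-- The lifting category with open covers: the least `n` with a categorical cover by `n + 1` open
sets, and `∞` if there is none. -/
noncomputable def liftcatOp (f : C(X, Y)) (ι : C(A, Y)) : ℕ∞ :=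
  sInf {m | ∃ n : ℕ, HasCatCover f ι n ∧ (n : ℕ∞) = m}

/-- The sectional category with open covers. -/
noncomputable def secatOp (ι : C(A, Y)) : ℕ∞ := liftcatOp (ContinuousMap.id Y) ι

/-- The homotopic distance with open covers. -/
noncomputable def distOp (f g : C(X, Y)) : ℕ∞ := liftcatOp (f.prodMk g) (diag Y)

/-- The topological complexity with open covers. -/
noncomputable def TCOp (Y : Type u) [TopologicalSpace Y] : ℕ∞ := secatOp (diag Y)

/-- The LS category with open covers, computed with the constant map `* → Y` at `y₀`. -/
noncomputable def catOp (Y : Type u) [TopologicalSpace Y] (y₀ : Y) : ℕ∞ :=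
  liftcatOp (ContinuousMap.id Y) (pointMap y₀)

end UnptLift

/-! ### The pointed setting: well-pointed spaces and basepoint-preserving maps -/

/-- A topological space with a basepoint. -/
structure PtSpace : Type (u + 1) where
  /-- the underlying type -/
  carrier : Type u
  [top : TopologicalSpace carrier]
  /-- the basepoint -/
  pt : carrier

namespace PtSpace

instance : CoeSort PtSpace.{u} (Type u) := ⟨PtSpace.carrier⟩

instance (X : PtSpace.{u}) : TopologicalSpace X := X.top

/-- `X` is well-pointed: the inclusion of the basepoint is a closed cofibration, i.e. the basepoint
is closed and its inclusion has the homotopy extension property. -/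
def WellPointed (X : PtSpace.{u}) : Prop :=
  IsClosed ({X.pt} : Set X) ∧
  ∀ (Z : Type u) [TopologicalSpace Z] (f : C(X, Z)) (γ : C(I, Z)), γ 0 = f X.pt →
    ∃ H : C(I × X, Z), (∀ x, H (0, x) = f x) ∧ ∀ t, H (t, X.pt) = γ t

/-- Continuous maps preserving basepoints. -/
structure Map (X Y : PtSpace.{u}) where
  /-- the underlying continuous map -/
  toCont : C(X, Y)
  map_pt : toCont X.pt = Y.pt

/-- The identity. -/
def Map.id (X : PtSpace.{u}) : Map X X := ⟨ContinuousMap.id X, rfl⟩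

/-- Composition. -/
def Map.comp {X Y Z : PtSpace.{u}} (g : Map Y Z) (f : Map X Y) : Map X Z :=
  ⟨g.toCont.comp f.toCont, by simp [f.map_pt, g.map_pt]⟩

/-- Pointed homotopy. -/
def Map.Homotopic {X Y : PtSpace.{u}} (f g : Map X Y) : Prop :=
  f.toCont.HomotopicRel g.toCont {X.pt}

/-- The product of pointed spaces. -/
def prod (X Y : PtSpace.{u}) : PtSpace.{u} := ⟨X × Y, (X.pt, Y.pt)⟩

/-- The map `(f, g)` into a product. -/
def Map.pair {X Y Z : PtSpace.{u}} (f : Map X Y) (g : Map X Z) : Map X (Y.prod Z) :=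
  ⟨f.toCont.prodMk g.toCont, Prod.ext f.map_pt g.map_pt⟩

/-- The diagonal map. -/
def diag (Y : PtSpace.{u}) : Map Y (Y.prod Y) := Map.pair (Map.id Y) (Map.id Y)

/-- The one-point space. -/
def point : PtSpace.{u} := ⟨PUnit.{u + 1}, PUnit.unit⟩

/-- The constant map `X → Y` in the pointed setting. -/
def const (X Y : PtSpace.{u}) : Map X Y := ⟨ContinuousMap.const X Y.pt, rfl⟩

/-- An open (or arbitrary) subset containing the basepoint, as a pointed space. -/
def sub (X : PtSpace.{u}) (U : Set X) (hU : X.pt ∈ U) : PtSpace.{u} := ⟨U, ⟨X.pt, hU⟩⟩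

/-- The restriction of a map to a subset containing the basepoint. -/
def Map.restrict {X Y : PtSpace.{u}} (f : Map X Y) (U : Set X) (hU : X.pt ∈ U) :
    Map (X.sub U hU) Y :=
  ⟨f.toCont.restrict U, f.map_pt⟩

/-- The standard homotopy pullback, pointed by the constant path at the basepoint. -/
def stdPullback {X A Y : PtSpace.{u}} (f : Map X Y) (ι : Map A Y) : PtSpace.{u} :=
  ⟨UnptLift.StdPullback f.toCont ι.toCont,
    ⟨(X.pt, ContinuousMap.const I Y.pt, A.pt), f.map_pt.symm, ι.map_pt.symm⟩⟩

/-- Homotopy pullback squares in the pointed setting: `w` is the map from `P` to the standard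
homotopy pullback induced by a pointed homotopy `f ∘ q ≃ ι ∘ p` (its path coordinate), and it has
to be a pointed homotopy equivalence. -/
def IsHomotopyPullback {P X A Y : PtSpace.{u}} (q : Map P X) (p : Map P A) (f : Map X Y)
    (ι : Map A Y) : Prop :=
  ∃ w : Map P (stdPullback f ι),
    (∀ z, (w.toCont z).1.1 = q.toCont z) ∧ (∀ z, (w.toCont z).1.2.2 = p.toCont z) ∧
    ∃ v : Map (stdPullback f ι) P,
      (v.comp w).Homotopic (Map.id P) ∧ (w.comp v).Homotopic (Map.id (stdPullback f ι))

/-- An abstract sectional category on well-pointed spaces. (Its values on maps between spaces that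
are not well-pointed are unconstrained and never used.) -/
structure SectionalCategory where
  /-- the sectional category of a map -/
  secat : ∀ {A Y : PtSpace.{u}}, Map A Y → ℕ∞
  /-- S0: `secat ι = 0` iff `ι` has a homotopy section. -/
  S0 : ∀ {A Y : PtSpace.{u}}, A.WellPointed → Y.WellPointed → ∀ ι : Map A Y,
    (secat ι = 0 ↔ ∃ s : Map Y A, (ι.comp s).Homotopic (Map.id Y))
  /-- S1: if `κ ≃ ι ∘ ζ` then `secat ι ≤ secat κ`. -/
  S1 : ∀ {A B X : PtSpace.{u}}, A.WellPointed → B.WellPointed → X.WellPointed →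
    ∀ (ι : Map A X) (κ : Map B X) (ζ : Map B A), (ι.comp ζ).Homotopic κ → secat ι ≤ secat κ
  /-- S2: `secat` does not increase under homotopy pullback. -/
  S2 : ∀ {P X A Y : PtSpace.{u}}, P.WellPointed → X.WellPointed → A.WellPointed →
    Y.WellPointed → ∀ (q : Map P X) (p : Map P A) (f : Map X Y) (ι : Map A Y),
    IsHomotopyPullback q p f ι → secat q ≤ secat ι

namespace SectionalCategory

variable (S : SectionalCategory.{u}) {X Y A : PtSpace.{u}}

/-- The lifting category from `f` to `ι`: the sectional category of `q : P → X`, where `P` is a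
well-pointed homotopy pullback of `f` and `ι`; by S1 all choices of `P` give the same value. -/
noncomputable def liftcat (f : Map X Y) (ι : Map A Y) : ℕ∞ :=
  sInf {m | ∃ (P : PtSpace.{u}) (_ : P.WellPointed) (q : Map P X) (p : Map P A),
    IsHomotopyPullback q p f ι ∧ S.secat q = m}

/-- The homotopic distance `D(f, g)`. -/
noncomputable def dist (f g : Map X Y) : ℕ∞ := S.liftcat (Map.pair f g) (diag Y)

/-- The topological complexity. -/
noncomputable def TC (Y : PtSpace.{u}) : ℕ∞ := S.secat (diag Y)

/-- The category of a map. -/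
noncomputable def catMap (f : Map X Y) : ℕ∞ := S.liftcat f (const point Y)

/-- The LS category of a space. -/
noncomputable def cat (Y : PtSpace.{u}) : ℕ∞ := S.catMap (Map.id Y)

end SectionalCategory

/-! The version with open covers; every open set of a cover contains the basepoint. -/

section OpenCovers

variable {X Y A : PtSpace.{u}}

/-- There is a categorical open cover of `X` by `n + 1` open sets for `f` and `ι`. -/
def HasCatCover (f : Map X Y) (ι : Map A Y) (n : ℕ) : Prop :=
  ∃ (U : Fin (n + 1) → Set X) (hU : ∀ i, X.pt ∈ U i),
    (∀ i, IsOpen (U i)) ∧ (∀ x, ∃ i, x ∈ U i) ∧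
    ∀ i, ∃ l : Map (X.sub (U i) (hU i)) A, (ι.comp l).Homotopic (f.restrict (U i) (hU i))

/-- The lifting category with open covers. -/
noncomputable def liftcatOp (f : Map X Y) (ι : Map A Y) : ℕ∞ :=
  sInf {m | ∃ n : ℕ, HasCatCover f ι n ∧ (n : ℕ∞) = m}

/-- The sectional category with open covers. -/
noncomputable def secatOp (ι : Map A Y) : ℕ∞ := liftcatOp (Map.id Y) ι

/-- The homotopic distance with open covers. -/
noncomputable def distOp (f g : Map X Y) : ℕ∞ := liftcatOp (Map.pair f g) (diag Y)

/-- The topological complexity with open covers. -/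
noncomputable def TCOp (Y : PtSpace.{u}) : ℕ∞ := secatOp (diag Y)

/-- The LS category with open covers. -/
noncomputable def catOp (Y : PtSpace.{u}) : ℕ∞ := liftcatOp (Map.id Y) (const point Y)

end OpenCovers

end PtSpace

/-!
Both versions of `liftcat f ι` depend only on the maps `κ` into the source of `f` for which `f ∘ κ`
lifts through `ι` up to homotopy: for an abstract `secat` the value is the infimum of `secat κ`
over these `κ`, by S1 and the universal property of the standard homotopy pullback; with open
covers the `κ` are the inclusions of the members of a cover. Hence an implication between two
lifting conditions gives an inequality between two lifting categories. Now `(f, g)` lifts through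
the diagonal along `κ` iff `f ∘ κ ≃ g ∘ κ`, and `f` lifts through a point iff `f ∘ κ` is homotopic
to that constant map. The lifting category is bounded by `secat`, by S2 or by pulling back covers.

In the pointed setting one also needs that the homotopy pullback `P` of `f : X → Y` and `ι : A → Y`
is well-pointed. Retractions of the cylinders on `X` and `A` lift to a homotopy of `P`, which
prolongs the paths in `Y` at both ends. Once the end points have reached the basepoint, the
remaining time is spent contracting the path by a retraction of the cylinder on the path space.
-/

namespace UnptLift

section Lifts

variable {X Y A B : Type u} [TopologicalSpace X] [TopologicalSpace Y] [TopologicalSpace A]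
  [TopologicalSpace B]

/-- The map `f ∘ κ` lifts through `ι` up to homotopy. Both versions of the lifting category depend
on `f` and `ι` only through this relation. -/
def LiftsAlong (f : C(X, Y)) (ι : C(A, Y)) (κ : C(B, X)) : Prop :=
  ∃ l : C(B, A), (ι.comp l).Homotopic (f.comp κ)

namespace StdPullback

/-- The projection of the standard homotopy pullback to the source of `f`. -/
def proj (f : C(X, Y)) (ι : C(A, Y)) : C(StdPullback f ι, X) :=
  ⟨fun w => w.1.1, by fun_prop⟩

/-- The projection of the standard homotopy pullback to the source of `ι`. -/
def coproj (f : C(X, Y)) (ι : C(A, Y)) : C(StdPullback f ι, A) :=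
  ⟨fun w => w.1.2.2, by fun_prop⟩

/-- The path coordinate of the standard homotopy pullback. -/
def path (f : C(X, Y)) (ι : C(A, Y)) : C(StdPullback f ι, C(I, Y)) :=
  ⟨fun w => w.1.2.1, by fun_prop⟩

end StdPullback

theorem isHomotopyPullback_stdPullback (f : C(X, Y)) (ι : C(A, Y)) :
    IsHomotopyPullback (StdPullback.proj f ι) (StdPullback.coproj f ι) f ι :=
  ⟨ContinuousMap.id _, fun _ => rfl, fun _ => rfl, ContinuousMap.id _, .refl _, .refl _⟩

theorem liftsAlong_iff_exists_proj_comp_eq {f : C(X, Y)} {ι : C(A, Y)} {κ : C(B, X)} :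
    LiftsAlong f ι κ ↔ ∃ ζ : C(B, StdPullback f ι), (StdPullback.proj f ι).comp ζ = κ := by
  constructor
  · rintro ⟨l, hl⟩
    obtain ⟨F⟩ := hl.symm
    let paths : C(B, C(I, Y)) := (F.toContinuousMap.comp ContinuousMap.prodSwap).curry
    exact ⟨⟨fun b => ⟨(κ b, paths b, l b), F.apply_zero b, F.apply_one b⟩, by fun_prop⟩, rfl⟩
  · rintro ⟨ζ, rfl⟩
    refine ⟨(StdPullback.coproj f ι).comp ζ, .symm ⟨⟨⟨fun z => (ζ z.2).1.2.1 z.1, ?_⟩, ?_, ?_⟩⟩⟩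
    · fun_prop
    · exact fun b => (ζ b).2.1
    · exact fun b => (ζ b).2.2

theorem IsHomotopyPullback.liftsAlong {q : C(B, X)} {p : C(B, A)} {f : C(X, Y)} {ι : C(A, Y)}
    (h : IsHomotopyPullback q p f ι) : LiftsAlong f ι q :=
  have ⟨w, hq, _⟩ := h
  liftsAlong_iff_exists_proj_comp_eq.2 ⟨w, ContinuousMap.ext hq⟩

theorem liftsAlong_diag_iff {f g : C(X, Y)} {κ : C(B, X)} :
    LiftsAlong (f.prodMk g) (diag Y) κ ↔ (f.comp κ).Homotopic (g.comp κ) := by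
  constructor
  · rintro ⟨l, hl⟩
    have hf : l.Homotopic (f.comp κ) := (ContinuousMap.Homotopic.refl ContinuousMap.fst).comp hl
    have hg : l.Homotopic (g.comp κ) := (ContinuousMap.Homotopic.refl ContinuousMap.snd).comp hl
    exact hf.symm.trans hg
  · intro h
    exact ⟨f.comp κ, (ContinuousMap.Homotopic.refl (f.comp κ)).prodMk h⟩

theorem liftsAlong_pointMap_iff {f : C(X, Y)} {y : Y} {κ : C(B, X)} :
    LiftsAlong f (pointMap y) κ ↔ (f.comp κ).Homotopic (ContinuousMap.const B y) :=
  ⟨fun ⟨_, hl⟩ => hl.symm, fun h => ⟨ContinuousMap.const B PUnit.unit, h.symm⟩⟩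

theorem homotopic_const_of_joined {y y' : Y} (h : Joined y y') :
    (ContinuousMap.const B y).Homotopic (ContinuousMap.const B y') :=
  (ContinuousMap.homotopic_const_iff (Y := Unit).2 h).comp (.refl (ContinuousMap.const B ()))

theorem liftsAlong_diag_const_iff_pointMap {f : C(X, Y)} {y₀ y₁ : Y} (h : Joined y₁ y₀)
    {κ : C(B, X)} :
    LiftsAlong (f.prodMk (ContinuousMap.const X y₁)) (diag Y) κ ↔
      LiftsAlong f (pointMap y₀) κ := by
  rw [liftsAlong_diag_iff, liftsAlong_pointMap_iff]
  exact ⟨fun hκ => hκ.trans (homotopic_const_of_joined h),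
    fun hκ => hκ.trans (homotopic_const_of_joined h.symm)⟩

theorem LiftsAlong.diag_of_pointMap {f : C(X, Y × Y)} {z : Y × Y} (h : Joined z.1 z.2)
    {κ : C(B, X)} (hκ : LiftsAlong f (pointMap z) κ) : LiftsAlong f (diag Y) κ :=
  ⟨ContinuousMap.const B z.1,
    (ContinuousMap.Homotopic.prodMk (.refl (ContinuousMap.const B z.1))
      (homotopic_const_of_joined h)).trans (liftsAlong_pointMap_iff.1 hκ).symm⟩

end Lifts

namespace SectionalCategory

variable (S : SectionalCategory.{u}) {X Y A Y' A' : Type u} [TopologicalSpace X]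
  [TopologicalSpace Y] [TopologicalSpace A] [TopologicalSpace Y'] [TopologicalSpace A']

theorem liftcat_le_secat_of_liftsAlong {f : C(X, Y)} {ι : C(A, Y)} {B : Type u}
    [TopologicalSpace B] [hB : Nonempty B] {κ : C(B, X)} (hκ : LiftsAlong f ι κ) :
    S.liftcat f ι ≤ S.secat κ := by
  obtain ⟨ζ, hζ⟩ := liftsAlong_iff_exists_proj_comp_eq.1 hκ
  have hP : Nonempty (StdPullback f ι) := hB.map ζ
  have hX : Nonempty X := hB.map κ
  refine le_trans (sInf_le ⟨_, _, hP, _, _, isHomotopyPullback_stdPullback f ι, rfl⟩) ?_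
  exact S.S1 _ κ ζ (hζ ▸ .refl _)

theorem liftcat_mono {f : C(X, Y)} {ι : C(A, Y)} {f' : C(X, Y')} {ι' : C(A', Y')}
    (h : ∀ {B : Type u} [TopologicalSpace B] {κ : C(B, X)},
      LiftsAlong f' ι' κ → LiftsAlong f ι κ) : S.liftcat f ι ≤ S.liftcat f' ι' := by
  refine le_sInf ?_
  rintro _ ⟨P, _, _, q, p, hq, rfl⟩
  exact S.liftcat_le_secat_of_liftsAlong (h hq.liftsAlong)

theorem liftcat_le_secat (f : C(X, Y)) (ι : C(A, Y)) [hP : Nonempty (StdPullback f ι)] :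
    S.liftcat f ι ≤ S.secat ι := by
  have : Nonempty X := hP.map (StdPullback.proj f ι)
  have : Nonempty A := hP.map (StdPullback.coproj f ι)
  have : Nonempty Y := this.map ι
  refine le_trans (sInf_le ⟨_, _, hP, _, _, isHomotopyPullback_stdPullback f ι, rfl⟩) ?_
  exact S.S2 _ _ _ _ (isHomotopyPullback_stdPullback f ι)

theorem secat_eq_liftcat_id [hA : Nonempty A] (ι : C(A, Y)) :
    S.secat ι = S.liftcat (ContinuousMap.id Y) ι := by
  refine le_antisymm (le_sInf ?_)
    (S.liftcat_le_secat_of_liftsAlong ⟨ContinuousMap.id A, .refl _⟩)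
  rintro _ ⟨P, _, _, q, p, hq, rfl⟩
  have : Nonempty Y := hA.map ι
  obtain ⟨l, hl⟩ := hq.liftsAlong
  exact S.S1 ι q l hl

theorem dist_const_eq_catMap (f : C(X, Y)) {y₀ y₁ : Y} (h : Joined y₁ y₀) :
    S.dist f (ContinuousMap.const X y₁) = S.catMap f y₀ :=
  le_antisymm (S.liftcat_mono (liftsAlong_diag_const_iff_pointMap h).2)
    (S.liftcat_mono (liftsAlong_diag_const_iff_pointMap h).1)

theorem dist_le_TC {f g : C(X, Y)} (h : ∃ x, Joined (f x) (g x)) : S.dist f g ≤ S.TC Y := by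
  obtain ⟨x, ⟨γ⟩⟩ := h
  have : Nonempty (StdPullback (f.prodMk g) (diag Y)) :=
    ⟨⟨(x, (ContinuousMap.const I (f x)).prodMk γ.symm, f x), by simp, by simp [diag]⟩⟩
  exact S.liftcat_le_secat _ _

theorem TC_le_cat_prod {z : Y × Y} (h : Joined z.1 z.2) : S.TC Y ≤ S.cat (Y × Y) z := by
  have : Nonempty Y := ⟨z.1⟩
  exact (S.secat_eq_liftcat_id (diag Y)).trans_le
    (S.liftcat_mono fun hκ => hκ.diag_of_pointMap h)

end SectionalCategory

section OpenCovers

variable {X Y A Y' A' : Type u} [TopologicalSpace X] [TopologicalSpace Y] [TopologicalSpace A]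
  [TopologicalSpace Y'] [TopologicalSpace A']

theorem liftcatOp_mono {f : C(X, Y)} {ι : C(A, Y)} {f' : C(X, Y')} {ι' : C(A', Y')}
    (h : ∀ {B : Type u} [TopologicalSpace B] {κ : C(B, X)},
      LiftsAlong f' ι' κ → LiftsAlong f ι κ) : liftcatOp f ι ≤ liftcatOp f' ι' := by
  refine sInf_le_sInf ?_
  rintro _ ⟨n, ⟨U, hU, hcover, hlift⟩, rfl⟩
  exact ⟨n, ⟨U, hU, hcover, fun i => h (κ := ⟨Subtype.val, continuous_subtype_val⟩) (hlift i)⟩,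
    rfl⟩

theorem liftcatOp_le_secatOp (f : C(X, Y)) (ι : C(A, Y)) : liftcatOp f ι ≤ secatOp ι := by
  refine sInf_le_sInf ?_
  rintro _ ⟨n, ⟨U, hU, hcover, hlift⟩, rfl⟩
  refine ⟨n, ⟨fun i => f ⁻¹' U i, fun i => (hU i).preimage f.continuous,
    fun x => hcover (f x), fun i => ?_⟩, rfl⟩
  obtain ⟨l, hl⟩ := hlift i
  exact ⟨l.comp (f.restrictPreimage (U i)), hl.comp (.refl (f.restrictPreimage (U i)))⟩

theorem distOp_const_eq_liftcatOp_pointMap (f : C(X, Y)) {y₀ y₁ : Y} (h : Joined y₁ y₀) :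
    distOp f (ContinuousMap.const X y₁) = liftcatOp f (pointMap y₀) :=
  le_antisymm (liftcatOp_mono (liftsAlong_diag_const_iff_pointMap h).2)
    (liftcatOp_mono (liftsAlong_diag_const_iff_pointMap h).1)

theorem distOp_le_TCOp (f g : C(X, Y)) : distOp f g ≤ TCOp Y :=
  liftcatOp_le_secatOp _ _

theorem TCOp_le_catOp_prod {z : Y × Y} (h : Joined z.1 z.2) : TCOp Y ≤ catOp (Y × Y) z :=
  liftcatOp_mono fun hκ => hκ.diag_of_pointMap h

end OpenCovers

section HomotopyLifting

variable {X Y A B : Type u} [TopologicalSpace X] [TopologicalSpace Y] [TopologicalSpace A]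
  [TopologicalSpace B]

/-- The path that runs back along `α` from `α t` to `α 0`, then along `γ`, then along `β` from
`β 0` to `β t`. It is parametrised by rescaling `[-t, 1 + t]` to `[0, 1]`, so that at `t = 0` it
is `γ` itself and not merely a reparametrisation of `γ`. -/
noncomputable def prolong (α γ β : C(I, Y)) (t s : I) : Y :=
  let u : ℝ := s * (1 + 2 * t) - t
  if u ≤ 0 then α (Set.projIcc 0 1 zero_le_one (-u))
  else if u ≤ 1 then γ (Set.projIcc 0 1 zero_le_one u)
  else β (Set.projIcc 0 1 zero_le_one (u - 1))

theorem prolong_time_zero {α γ β : C(I, Y)} (hα : α 0 = γ 0) (s : I) :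
    prolong α γ β 0 s = γ s := by
  rcases eq_or_ne s 0 with rfl | hs
  · simp [prolong, hα]
  · have hs' : ¬ (s : ℝ) ≤ 0 := not_le.2 (unitInterval.pos_iff_ne_zero.2 hs)
    simp [prolong, s.2.2, hs']

theorem prolong_apply_zero (α γ β : C(I, Y)) (t : I) : prolong α γ β t 0 = α t := by
  simp [prolong, t.2.1]

theorem prolong_apply_one {α γ β : C(I, Y)} (hβ : γ 1 = β 0) (t : I) :
    prolong α γ β t 1 = β t := by
  have hu : ((1 : I) : ℝ) * (1 + 2 * t) - t = 1 + t := by push_cast; ring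
  have hu₀ : ¬ (1 + t : ℝ) ≤ 0 := by linarith [t.2.1]
  simp only [prolong, hu, if_neg hu₀]
  rcases eq_or_ne t 0 with rfl | ht
  · simp [hβ]
  · have hu₁ : ¬ (1 + t : ℝ) ≤ 1 := by
      linarith [unitInterval.coe_pos.2 (unitInterval.pos_iff_ne_zero.2 ht)]
    rw [if_neg hu₁]
    simp

theorem prolong_of_forall_eq {α γ β : C(I, Y)} {y : Y} (hα : ∀ r, α r = y) (hγ : ∀ r, γ r = y)
    (hβ : ∀ r, β r = y) (t s : I) : prolong α γ β t s = y := by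
  simp [prolong, hα, hγ, hβ]

theorem continuous_prolong {α γ β : B → C(I, Y)} {t s : B → I} (hα : Continuous α)
    (hγ : Continuous γ) (hβ : Continuous β) (ht : Continuous t) (hs : Continuous s)
    (hαγ : ∀ b, α b 0 = γ b 0) (hγβ : ∀ b, γ b 1 = β b 0) :
    Continuous fun b => prolong (α b) (γ b) (β b) (t b) (s b) := by
  unfold prolong
  have hproj {v : B → ℝ} (hv : Continuous v) :
      Continuous fun b => Set.projIcc (0 : ℝ) 1 zero_le_one (v b) :=
    continuous_projIcc.comp hv
  refine Continuous.if_le ?_ (Continuous.if_le ?_ ?_ ?_ continuous_const ?_) ?_ continuous_const ?_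
  · exact hα.eval (hproj (by fun_prop))
  · exact hγ.eval (hproj (by fun_prop))
  · exact hβ.eval (hproj (by fun_prop))
  · fun_prop
  · intro b hb
    simp [hb, hγβ]
  · fun_prop
  · intro b hb
    simp [hb, hαγ]

theorem StdPullback.exists_homotopy_lift {f : C(X, Y)} {ι : C(A, Y)} (φ : C(B, StdPullback f ι))
    (α : C(I × B, X)) (β : C(I × B, A)) (hα : ∀ b, α (0, b) = proj f ι (φ b))
    (hβ : ∀ b, β (0, b) = coproj f ι (φ b)) :
    ∃ Φ : C(I × B, StdPullback f ι), (proj f ι).comp Φ = α ∧ (coproj f ι).comp Φ = β ∧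
      (∀ b, Φ (0, b) = φ b) ∧
      ∀ b y, (∀ t, f (α (t, b)) = y) → (∀ s, path f ι (φ b) s = y) → (∀ t, ι (β (t, b)) = y) →
        ∀ t s, path f ι (Φ (t, b)) s = y := by
  let fα : C(B, C(I, Y)) := (f.comp (α.comp ContinuousMap.prodSwap)).curry
  let ιβ : C(B, C(I, Y)) := (ι.comp (β.comp ContinuousMap.prodSwap)).curry
  let γ : C(B, C(I, Y)) := (path f ι).comp φ
  have hαγ : ∀ b, fα b 0 = γ b 0 := fun b =>
    (congrArg f (hα b)).trans (φ b).2.1.symm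
  have hγβ : ∀ b, γ b 1 = ιβ b 0 := fun b =>
    (φ b).2.2.trans (congrArg ι (hβ b)).symm
  let paths : C(I × B, C(I, Y)) := ContinuousMap.curry
    ⟨fun z => prolong (fα z.1.2) (γ z.1.2) (ιβ z.1.2) z.1.1 z.2,
      continuous_prolong (by fun_prop) (by fun_prop) (by fun_prop) (by fun_prop) (by fun_prop)
        (fun _ => hαγ _) (fun _ => hγβ _)⟩
  refine ⟨⟨fun z => ⟨(α z, paths z, β z), prolong_apply_zero _ _ _ _,
    prolong_apply_one (hγβ _) _⟩, by fun_prop⟩, rfl, rfl, fun b => ?_, fun b y hfα hγ hιβ => ?_⟩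
  · have hpath : paths (0, b) = γ b := ContinuousMap.ext fun s => prolong_time_zero (hαγ b) s
    exact Subtype.ext (Prod.ext (hα b) (Prod.ext hpath (hβ b)))
  · exact fun t s =>
      prolong_of_forall_eq (α := fα b) (γ := γ b) (β := ιβ b) hfα hγ hιβ t s

end HomotopyLifting

end UnptLift

namespace PtSpace

section Homotopy

variable {X Y Z : PtSpace.{u}}

attribute [ext] Map

theorem Map.Homotopic.refl (f : Map X Y) : f.Homotopic f :=
  ContinuousMap.HomotopicRel.refl f.toCont

theorem Map.Homotopic.symm {f g : Map X Y} (h : f.Homotopic g) : g.Homotopic f :=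
  ContinuousMap.HomotopicRel.symm h

theorem Map.Homotopic.trans {f g k : Map X Y} (hfg : f.Homotopic g) (hgk : g.Homotopic k) :
    f.Homotopic k :=
  ContinuousMap.HomotopicRel.trans hfg hgk

theorem Map.Homotopic.postcomp {f g : Map X Y} (h : f.Homotopic g) (k : Map Y Z) :
    (k.comp f).Homotopic (k.comp g) :=
  ContinuousMap.HomotopicRel.comp_continuousMap h k.toCont

theorem Map.Homotopic.precomp {f g : Map Y Z} (h : f.Homotopic g) (k : Map X Y) :
    (f.comp k).Homotopic (g.comp k) := by
  obtain ⟨F⟩ := h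
  refine ⟨⟨F.toHomotopy.compContinuousMap k.toCont, ?_⟩⟩
  rintro t x rfl
  exact F.eq_fst t k.map_pt

theorem Map.Homotopic.pair {f f' : Map X Y} {g g' : Map X Z} (hf : f.Homotopic f')
    (hg : g.Homotopic g') : (Map.pair f g).Homotopic (Map.pair f' g') := by
  obtain ⟨F⟩ := hf
  obtain ⟨G⟩ := hg
  exact ⟨F.prod G⟩

/-- The first projection of a product of pointed spaces. -/
def Map.fst (Y Z : PtSpace.{u}) : Map (Y.prod Z) Y := ⟨ContinuousMap.fst, rfl⟩

/-- The second projection of a product of pointed spaces. -/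
def Map.snd (Y Z : PtSpace.{u}) : Map (Y.prod Z) Z := ⟨ContinuousMap.snd, rfl⟩

end Homotopy

section CylinderRetraction

/-- A retraction of `I × X` onto `{0} × X ∪ I × {pt}`, given by its two coordinates. For a closed
basepoint its existence is equivalent to well-pointedness, and it is easier to construct than
homotopy extensions. -/
structure CylinderRetraction (X : PtSpace.{u}) where
  /-- the coordinate in `X` -/
  pos : C(I × X, X)
  /-- the coordinate in `I` -/
  time : C(I × X, I)
  pos_zero : ∀ x, pos (0, x) = x
  time_zero : ∀ x, time (0, x) = 0
  pos_pt : ∀ t, pos (t, X.pt) = X.pt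
  time_pt : ∀ t, time (t, X.pt) = t
  time_eq_zero_or : ∀ z, time z = 0 ∨ pos z = X.pt

variable {X Y A : PtSpace.{u}}

theorem WellPointed.nonempty_cylinderRetraction (h : X.WellPointed) :
    Nonempty (CylinderRetraction X) := by
  obtain ⟨H, h₀, h₁⟩ := h.2 {z : X × I // z.2 = 0 ∨ z.1 = X.pt}
    ⟨fun x => ⟨(x, 0), .inl rfl⟩, by fun_prop⟩
    ⟨fun t => ⟨(X.pt, t), .inr rfl⟩, by fun_prop⟩ rfl
  exact ⟨{
    pos := ⟨fun z => (H z).1.1, by fun_prop⟩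
    time := ⟨fun z => (H z).1.2, by fun_prop⟩
    pos_zero := fun x => by simp [h₀]
    time_zero := fun x => by simp [h₀]
    pos_pt := fun t => by simp [h₁]
    time_pt := fun t => by simp [h₁]
    time_eq_zero_or := fun z => (H z).2 }⟩

theorem CylinderRetraction.wellPointed (r : CylinderRetraction X)
    (hX : IsClosed ({X.pt} : Set X)) : X.WellPointed := by
  classical
  refine ⟨hX, fun Z _ f γ hγ => ?_⟩
  let H : I × X → Z := fun z => if r.time z = 0 then f (r.pos z) else γ (r.time z)
  have hH_time : ∀ z, r.time z = 0 → H z = f (r.pos z) := fun z hz => if_pos hz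
  have hH_pos : ∀ z, r.pos z = X.pt → H z = γ (r.time z) := by
    intro z hz
    by_cases h : r.time z = 0
    · rw [hH_time z h, hz, h, hγ]
    · exact if_neg h
  have hH : Continuous H := by
    rw [← continuousOn_univ,
      ← Set.eq_univ_of_forall (s := {z | r.time z = 0} ∪ {z | r.pos z = X.pt}) r.time_eq_zero_or]
    refine ContinuousOn.union_of_isClosed ?_ ?_
      (isClosed_eq r.time.continuous continuous_const) (hX.preimage r.pos.continuous)
    · exact ContinuousOn.congr (f := fun z => f (r.pos z)) (by fun_prop) hH_time
    · exact ContinuousOn.congr (f := fun z => γ (r.time z)) (by fun_prop) hH_pos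
  refine ⟨⟨H, hH⟩, fun x => ?_, fun t => ?_⟩
  · exact (hH_time _ (r.time_zero x)).trans (by rw [r.pos_zero])
  · exact (hH_pos _ (r.pos_pt t)).trans (by rw [r.time_pt])

theorem CylinderRetraction.pos_time_map (r : CylinderRetraction X) (k : CylinderRetraction Y)
    (f : Map X Y) (z : I × X) :
    k.pos (r.time z, f.toCont (r.pos z)) = f.toCont (r.pos z) := by
  rcases r.time_eq_zero_or z with h | h
  · rw [h, k.pos_zero]
  · rw [h, f.map_pt, k.pos_pt]

/-- The retraction of the cylinder on a product, whose time coordinate is the minimum of the time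
coordinates of the factors. -/
def CylinderRetraction.prod (r : CylinderRetraction X) (s : CylinderRetraction Y) :
    CylinderRetraction (X.prod Y) where
  pos := ⟨fun z : I × X × Y => (r.pos (z.1, z.2.1), s.pos (z.1, z.2.2)), by fun_prop⟩
  time := ⟨fun z : I × X × Y => min (r.time (z.1, z.2.1)) (s.time (z.1, z.2.2)), by fun_prop⟩
  pos_zero _ := Prod.ext (r.pos_zero _) (s.pos_zero _)
  time_zero x := (congrArg₂ min (r.time_zero x.1) (s.time_zero x.2)).trans (min_self 0)
  pos_pt t := Prod.ext (r.pos_pt t) (s.pos_pt t)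
  time_pt t := (congrArg₂ min (r.time_pt t) (s.time_pt t)).trans (min_self t)
  time_eq_zero_or z := by
    rcases r.time_eq_zero_or (z.1, z.2.1) with hr | hr
    · exact .inl ((congrArg (min · _) hr).trans (min_eq_left unitInterval.nonneg'))
    rcases s.time_eq_zero_or (z.1, z.2.2) with hs | hs
    · exact .inl ((congrArg (min _ ·) hs).trans (min_eq_right unitInterval.nonneg'))
    · exact .inr (Prod.ext hr hs)

theorem WellPointed.prod (hX : X.WellPointed) (hY : Y.WellPointed) : (X.prod Y).WellPointed := by
  obtain ⟨r⟩ := hX.nonempty_cylinderRetraction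
  obtain ⟨s⟩ := hY.nonempty_cylinderRetraction
  have hpt : IsClosed ({X.pt} ×ˢ {Y.pt} : Set (X × Y)) := hX.1.prod hY.1
  rw [Set.singleton_prod_singleton] at hpt
  exact (r.prod s).wellPointed hpt

theorem wellPointed_point : point.{u}.WellPointed :=
  ⟨isClosed_discrete (α := PUnit.{u + 1}) _, fun _ _ _ γ hγ =>
    ⟨γ.comp ContinuousMap.fst, fun _ => hγ, fun _ => rfl⟩⟩

/-- The space of free paths in `Y`, pointed by the constant path at the basepoint. -/
def pathSpace (Y : PtSpace.{u}) : PtSpace.{u} := ⟨C(I, Y), ContinuousMap.const I Y.pt⟩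

theorem CylinderRetraction.continuous_iInf_time (k : CylinderRetraction Y) :
    Continuous fun z : I × C(I, Y) => ⨅ s, k.time (z.1, z.2 s) := by
  simp only [iInf, ← Set.image_univ]
  refine isCompact_univ.continuous_sInf ?_
  change Continuous fun z : (I × C(I, Y)) × I => k.time (z.1.1, z.1.2 z.2)
  fun_prop

/-- The retraction of the cylinder on the path space, given pointwise, with time coordinate the
minimum along the path. -/
noncomputable def CylinderRetraction.pathSpace (k : CylinderRetraction Y) :
    CylinderRetraction (pathSpace Y) where
  pos := ContinuousMap.curry
    ⟨fun z : (I × C(I, Y)) × I => k.pos (z.1.1, z.1.2 z.2), by fun_prop⟩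
  time := ⟨fun z : I × C(I, Y) => ⨅ s, k.time (z.1, z.2 s), k.continuous_iInf_time⟩
  pos_zero _ := ContinuousMap.ext fun _ => k.pos_zero _
  time_zero γ := (iInf_congr fun _ => k.time_zero _).trans iInf_const
  pos_pt t := ContinuousMap.ext fun _ => k.pos_pt t
  time_pt t := (iInf_congr fun _ => k.time_pt t).trans iInf_const
  time_eq_zero_or z := by
    by_cases h : ∃ s : I, k.time (z.1, z.2.1 s) = 0
    · obtain ⟨s, hs⟩ := h
      exact .inl (le_bot_iff.1 ((iInf_le _ s).trans hs.le))
    · push Not at h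
      exact .inr (ContinuousMap.ext fun s => (k.time_eq_zero_or _).resolve_left (h s))

theorem isClosed_pt_stdPullback {f : Map X Y} {ι : Map A Y} (hX : IsClosed ({X.pt} : Set X))
    (hA : IsClosed ({A.pt} : Set A)) (hY : IsClosed ({Y.pt} : Set Y)) :
    IsClosed ({(stdPullback f ι).pt} : Set (stdPullback f ι)) := by
  have hpath : IsClosed ({ContinuousMap.const I Y.pt} : Set C(I, Y)) := by
    have : ({ContinuousMap.const I Y.pt} : Set C(I, Y)) = ⋂ s : I, {γ | γ s = Y.pt} := by
      ext γ
      simp [ContinuousMap.ext_iff]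
    rw [this]
    exact isClosed_iInter fun s => hY.preimage (continuous_eval_const s)
  have hpt := (hX.prod (hpath.prod hA)).preimage
    (continuous_subtype_val (p := fun w : X × C(I, Y) × A =>
      w.2.1 0 = f.toCont w.1 ∧ w.2.1 1 = ι.toCont w.2.2))
  rw [Set.singleton_prod_singleton, Set.singleton_prod_singleton] at hpt
  refine (congrArg IsClosed (Set.ext fun w => ?_)).mpr hpt
  exact Subtype.ext_iff

theorem exists_path_homotopy_lift (f : Map X Y) (ι : Map A Y) (r : CylinderRetraction X)
    (s : CylinderRetraction A) :
    ∃ γ : C(I × UnptLift.StdPullback f.toCont ι.toCont, C(I, Y)),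
      (∀ z, γ z 0 = f.toCont (r.pos (z.1, z.2.1.1))) ∧
      (∀ z, γ z 1 = ι.toCont (s.pos (z.1, z.2.1.2.2))) ∧
      (∀ w, γ (0, w) = w.1.2.1) ∧
      ∀ t, γ (t, (stdPullback f ι).pt) = ContinuousMap.const I Y.pt := by
  let α : C(I × UnptLift.StdPullback f.toCont ι.toCont, X) :=
    ⟨fun z => r.pos (z.1, z.2.1.1), by fun_prop⟩
  let β : C(I × UnptLift.StdPullback f.toCont ι.toCont, A) :=
    ⟨fun z => s.pos (z.1, z.2.1.2.2), by fun_prop⟩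
  obtain ⟨Φ, hΦ_proj, hΦ_coproj, hΦ_zero, hΦ_const⟩ := UnptLift.StdPullback.exists_homotopy_lift
    (ContinuousMap.id _) α β (fun w => r.pos_zero w.1.1) (fun w => s.pos_zero w.1.2.2)
  refine ⟨(UnptLift.StdPullback.path f.toCont ι.toCont).comp Φ, fun z => ?_, fun z => ?_,
    fun w => congrArg (fun v => v.1.2.1) (hΦ_zero w), fun t => ContinuousMap.ext ?_⟩
  · exact (Φ z).2.1.trans (congrArg f.toCont (DFunLike.congr_fun hΦ_proj z))
  · exact (Φ z).2.2.trans (congrArg ι.toCont (DFunLike.congr_fun hΦ_coproj z))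
  · exact hΦ_const (stdPullback f ι).pt Y.pt
      (fun t => (congrArg f.toCont (r.pos_pt t)).trans f.map_pt) (fun _ => rfl)
      (fun t => (congrArg ι.toCont (s.pos_pt t)).trans ι.map_pt) t

theorem nonempty_cylinderRetraction_stdPullback (f : Map X Y) (ι : Map A Y)
    (r : CylinderRetraction X) (s : CylinderRetraction A) (k : CylinderRetraction Y) :
    Nonempty (CylinderRetraction (stdPullback f ι)) := by
  obtain ⟨γ, hγ_zero, hγ_one, hγ_init, hγ_pt⟩ := exists_path_homotopy_lift f ι r s
  let R := r.prod s
  let K := k.pathSpace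
  let ends : C(I × UnptLift.StdPullback f.toCont ι.toCont, I × X.prod A) :=
    ContinuousMap.fst.prodMk (((UnptLift.StdPullback.proj f.toCont ι.toCont).prodMk
      (UnptLift.StdPullback.coproj f.toCont ι.toCont)).comp ContinuousMap.snd)
  let θ := R.time.comp ends
  let δ : C(I × UnptLift.StdPullback f.toCont ι.toCont, C(I, Y)) := K.pos.comp (θ.prodMk γ)
  have hδ_zero : ∀ z, δ z 0 = f.toCont (r.pos (z.1, z.2.1.1)) := fun z =>
    (congrArg (fun y => k.pos (θ z, y)) (hγ_zero z)).trans
      (R.pos_time_map k (f.comp (Map.fst X A)) (ends z))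
  have hδ_one : ∀ z, δ z 1 = ι.toCont (s.pos (z.1, z.2.1.2.2)) := fun z =>
    (congrArg (fun y => k.pos (θ z, y)) (hγ_one z)).trans
      (R.pos_time_map k (ι.comp (Map.snd X A)) (ends z))
  have h_init : ∀ w, (θ.prodMk γ) (0, w) = (0, w.1.2.1) := fun w =>
    Prod.ext (R.time_zero (w.1.1, w.1.2.2)) (hγ_init w)
  have h_pt : ∀ t, (θ.prodMk γ) (t, (stdPullback f ι).pt) = (t, (pathSpace Y).pt) := fun t =>
    Prod.ext (R.time_pt t) (hγ_pt t)
  exact ⟨{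
    pos := ⟨fun z => ⟨(r.pos (z.1, z.2.1.1), δ z, s.pos (z.1, z.2.1.2.2)), hδ_zero z, hδ_one z⟩,
      by
        change Continuous fun z : I × UnptLift.StdPullback f.toCont ι.toCont => _
        fun_prop⟩
    time := K.time.comp (θ.prodMk γ)
    pos_zero := fun w => Subtype.ext (Prod.ext (r.pos_zero _) (Prod.ext
      ((congrArg K.pos (h_init w)).trans (K.pos_zero _)) (s.pos_zero _)))
    time_zero := fun w => (congrArg K.time (h_init w)).trans (K.time_zero _)
    pos_pt := fun t => Subtype.ext (Prod.ext (r.pos_pt t) (Prod.ext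
      ((congrArg K.pos (h_pt t)).trans (K.pos_pt t)) (s.pos_pt t)))
    time_pt := fun t => (congrArg K.time (h_pt t)).trans (K.time_pt t)
    time_eq_zero_or := fun z => by
      rcases R.time_eq_zero_or (ends z) with hθ | hR
      · exact .inl ((congrArg (fun t => K.time (t, γ z)) hθ).trans (K.time_zero _))
      · obtain ⟨hr, hs⟩ := Prod.ext_iff.1 hR
        exact (K.time_eq_zero_or ((θ.prodMk γ) z)).imp_right fun hK =>
          Subtype.ext (Prod.ext hr (Prod.ext hK hs)) }⟩

theorem WellPointed.stdPullback {f : Map X Y} {ι : Map A Y} (hX : X.WellPointed)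
    (hA : A.WellPointed) (hY : Y.WellPointed) : (stdPullback f ι).WellPointed := by
  obtain ⟨r⟩ := hX.nonempty_cylinderRetraction
  obtain ⟨s⟩ := hA.nonempty_cylinderRetraction
  obtain ⟨k⟩ := hY.nonempty_cylinderRetraction
  obtain ⟨e⟩ := nonempty_cylinderRetraction_stdPullback f ι r s k
  exact e.wellPointed (isClosed_pt_stdPullback hX.1 hA.1 hY.1)

end CylinderRetraction

section Lifts

variable {X Y A B : PtSpace.{u}}

/-- The map `f ∘ κ` lifts through `ι` up to pointed homotopy. -/
def LiftsAlong (f : Map X Y) (ι : Map A Y) (κ : Map B X) : Prop :=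
  ∃ l : Map B A, (ι.comp l).Homotopic (f.comp κ)

/-- The projection of the standard homotopy pullback to the source of `f`, as a pointed map. -/
def stdProj (f : Map X Y) (ι : Map A Y) : Map (stdPullback f ι) X :=
  ⟨UnptLift.StdPullback.proj f.toCont ι.toCont, rfl⟩

/-- The projection of the standard homotopy pullback to the source of `ι`, as a pointed map. -/
def stdCoproj (f : Map X Y) (ι : Map A Y) : Map (stdPullback f ι) A :=
  ⟨UnptLift.StdPullback.coproj f.toCont ι.toCont, rfl⟩

theorem isHomotopyPullback_stdPullback (f : Map X Y) (ι : Map A Y) :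
    IsHomotopyPullback (stdProj f ι) (stdCoproj f ι) f ι :=
  ⟨Map.id _, fun _ => rfl, fun _ => rfl, Map.id _, .refl _, .refl _⟩

theorem liftsAlong_iff_exists_stdProj_comp_eq {f : Map X Y} {ι : Map A Y} {κ : Map B X} :
    LiftsAlong f ι κ ↔ ∃ ζ : Map B (stdPullback f ι), (stdProj f ι).comp ζ = κ := by
  constructor
  · rintro ⟨l, hl⟩
    obtain ⟨F⟩ := hl.symm
    let paths : C(B, C(I, Y)) := (F.toContinuousMap.comp ContinuousMap.prodSwap).curry
    have hpaths : paths B.pt = ContinuousMap.const I Y.pt :=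
      ContinuousMap.ext fun t => (F.eq_fst t rfl).trans (f.comp κ).map_pt
    let ζ : C(B, UnptLift.StdPullback f.toCont ι.toCont) :=
      ⟨fun b => ⟨(κ.toCont b, paths b, l.toCont b), F.apply_zero b, F.apply_one b⟩, by fun_prop⟩
    exact ⟨⟨ζ, Subtype.ext (Prod.ext κ.map_pt (Prod.ext hpaths l.map_pt))⟩, rfl⟩
  · rintro ⟨ζ, rfl⟩
    let paths : C(B, C(I, Y)) := (UnptLift.StdPullback.path f.toCont ι.toCont).comp ζ.toCont
    have hpaths : paths B.pt = ContinuousMap.const I Y.pt :=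
      congrArg (UnptLift.StdPullback.path f.toCont ι.toCont) ζ.map_pt
    refine ⟨(stdCoproj f ι).comp ζ,
      .symm ⟨⟨⟨⟨fun z => paths z.2 z.1, by fun_prop⟩, fun b => ?_, fun b => ?_⟩, ?_⟩⟩⟩
    · exact (ζ.toCont b).2.1
    · exact (ζ.toCont b).2.2
    · rintro t b rfl
      exact (DFunLike.congr_fun hpaths t).trans (f.comp ((stdProj f ι).comp ζ)).map_pt.symm

theorem IsHomotopyPullback.liftsAlong {q : Map B X} {p : Map B A} {f : Map X Y} {ι : Map A Y}
    (h : IsHomotopyPullback q p f ι) : LiftsAlong f ι q :=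
  have ⟨w, hq, _⟩ := h
  liftsAlong_iff_exists_stdProj_comp_eq.2 ⟨w, Map.ext (ContinuousMap.ext hq)⟩

theorem liftsAlong_diag_iff {f g : Map X Y} {κ : Map B X} :
    LiftsAlong (Map.pair f g) (diag Y) κ ↔ (f.comp κ).Homotopic (g.comp κ) := by
  constructor
  · rintro ⟨l, hl⟩
    have hf : l.Homotopic (f.comp κ) := hl.postcomp (Map.fst Y Y)
    have hg : l.Homotopic (g.comp κ) := hl.postcomp (Map.snd Y Y)
    exact hf.symm.trans hg
  · intro h
    exact ⟨f.comp κ, (Map.Homotopic.refl (f.comp κ)).pair h⟩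

theorem liftsAlong_const_point_iff {f : Map X Y} {κ : Map B X} :
    LiftsAlong f (const point Y) κ ↔ (f.comp κ).Homotopic (const B Y) :=
  ⟨fun ⟨_, hl⟩ => hl.symm, fun h => ⟨const B point, h.symm⟩⟩

theorem liftsAlong_diag_const_iff_const_point {f : Map X Y} {κ : Map B X} :
    LiftsAlong (Map.pair f (const X Y)) (diag Y) κ ↔ LiftsAlong f (const point Y) κ :=
  liftsAlong_diag_iff.trans liftsAlong_const_point_iff.symm

theorem LiftsAlong.diag_of_const_point {f : Map X (Y.prod Y)} {κ : Map B X}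
    (hκ : LiftsAlong f (const point (Y.prod Y)) κ) : LiftsAlong f (diag Y) κ :=
  ⟨const B Y, (liftsAlong_const_point_iff.1 hκ).symm⟩

end Lifts

namespace SectionalCategory

variable (S : SectionalCategory.{u}) {X Y A B Y' A' : PtSpace.{u}}

theorem liftcat_le_secat_of_liftsAlong (hX : X.WellPointed) (hA : A.WellPointed)
    (hY : Y.WellPointed) (hB : B.WellPointed) {f : Map X Y} {ι : Map A Y} {κ : Map B X}
    (hκ : LiftsAlong f ι κ) : S.liftcat f ι ≤ S.secat κ := by
  obtain ⟨ζ, hζ⟩ := liftsAlong_iff_exists_stdProj_comp_eq.1 hκ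
  have hP : (stdPullback f ι).WellPointed := hX.stdPullback hA hY
  refine le_trans (sInf_le ⟨_, hP, _, _, isHomotopyPullback_stdPullback f ι, rfl⟩) ?_
  exact S.S1 hP hB hX _ κ ζ (hζ ▸ .refl _)

theorem liftcat_mono (hX : X.WellPointed) (hA : A.WellPointed) (hY : Y.WellPointed)
    {f : Map X Y} {ι : Map A Y} {f' : Map X Y'} {ι' : Map A' Y'}
    (h : ∀ {B : PtSpace.{u}} {κ : Map B X}, LiftsAlong f' ι' κ → LiftsAlong f ι κ) :
    S.liftcat f ι ≤ S.liftcat f' ι' := by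
  refine le_sInf ?_
  rintro _ ⟨P, hP, q, p, hq, rfl⟩
  exact S.liftcat_le_secat_of_liftsAlong hX hA hY hP (h hq.liftsAlong)

theorem liftcat_le_secat (hX : X.WellPointed) (hA : A.WellPointed) (hY : Y.WellPointed)
    (f : Map X Y) (ι : Map A Y) : S.liftcat f ι ≤ S.secat ι := by
  have hP : (stdPullback f ι).WellPointed := hX.stdPullback hA hY
  refine le_trans (sInf_le ⟨_, hP, _, _, isHomotopyPullback_stdPullback f ι, rfl⟩) ?_
  exact S.S2 hP hX hA hY _ _ f ι (isHomotopyPullback_stdPullback f ι)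

theorem secat_eq_liftcat_id (hA : A.WellPointed) (hY : Y.WellPointed) (ι : Map A Y) :
    S.secat ι = S.liftcat (Map.id Y) ι := by
  refine le_antisymm (le_sInf ?_) (S.liftcat_le_secat hY hA hY (Map.id Y) ι)
  rintro _ ⟨P, hP, q, p, hq, rfl⟩
  obtain ⟨l, hl⟩ := hq.liftsAlong
  exact S.S1 hA hP hY ι q l hl

theorem dist_const_eq_catMap (hX : X.WellPointed) (hY : Y.WellPointed) (f : Map X Y) :
    S.dist f (const X Y) = S.catMap f :=
  le_antisymm
    (S.liftcat_mono hX hY (hY.prod hY) liftsAlong_diag_const_iff_const_point.2)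
    (S.liftcat_mono hX wellPointed_point hY liftsAlong_diag_const_iff_const_point.1)

theorem dist_le_TC (hX : X.WellPointed) (hY : Y.WellPointed) (f g : Map X Y) :
    S.dist f g ≤ S.TC Y :=
  S.liftcat_le_secat hX hY (hY.prod hY) _ _

theorem TC_le_cat_prod (hY : Y.WellPointed) : S.TC Y ≤ S.cat (Y.prod Y) :=
  have hYY := hY.prod hY
  (S.secat_eq_liftcat_id hY hYY (diag Y)).trans_le
    (S.liftcat_mono hYY hY hYY LiftsAlong.diag_of_const_point)

end SectionalCategory

section OpenCovers

variable {X Y A Y' A' : PtSpace.{u}}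

theorem liftcatOp_mono {f : Map X Y} {ι : Map A Y} {f' : Map X Y'} {ι' : Map A' Y'}
    (h : ∀ {B : PtSpace.{u}} {κ : Map B X}, LiftsAlong f' ι' κ → LiftsAlong f ι κ) :
    liftcatOp f ι ≤ liftcatOp f' ι' := by
  refine sInf_le_sInf ?_
  rintro _ ⟨n, ⟨U, hpt, hU, hcover, hlift⟩, rfl⟩
  exact ⟨n, ⟨U, hpt, hU, hcover, fun i => h (κ := (Map.id X).restrict (U i) (hpt i)) (hlift i)⟩,
    rfl⟩

theorem liftcatOp_le_secatOp (f : Map X Y) (ι : Map A Y) : liftcatOp f ι ≤ secatOp ι := by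
  refine sInf_le_sInf ?_
  rintro _ ⟨n, ⟨U, hpt, hU, hcover, hlift⟩, rfl⟩
  have hpt' : ∀ i, X.pt ∈ f.toCont ⁻¹' U i := fun i => by
    rw [Set.mem_preimage, f.map_pt]
    exact hpt i
  refine ⟨n, ⟨fun i => f.toCont ⁻¹' U i, hpt', fun i => (hU i).preimage f.toCont.continuous,
    fun x => hcover (f.toCont x), fun i => ?_⟩, rfl⟩
  obtain ⟨l, hl⟩ := hlift i
  let g : Map (X.sub (f.toCont ⁻¹' U i) (hpt' i)) (Y.sub (U i) (hpt i)) :=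
    ⟨f.toCont.restrictPreimage (U i), Subtype.ext f.map_pt⟩
  exact ⟨l.comp g, hl.precomp g⟩

theorem distOp_const_eq_liftcatOp_const_point (f : Map X Y) :
    distOp f (const X Y) = liftcatOp f (const point Y) :=
  le_antisymm (liftcatOp_mono liftsAlong_diag_const_iff_const_point.2)
    (liftcatOp_mono liftsAlong_diag_const_iff_const_point.1)

theorem distOp_le_TCOp (f g : Map X Y) : distOp f g ≤ TCOp Y :=
  liftcatOp_le_secatOp _ _

theorem TCOp_le_catOp_prod (Y : PtSpace.{u}) : TCOp Y ≤ catOp (Y.prod Y) :=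
  liftcatOp_mono LiftsAlong.diag_of_const_point

end OpenCovers

end PtSpace

theorem mainTheorem10_general :
    (∀ (S : UnptLift.SectionalCategory.{u}) (X Y : Type u) [TopologicalSpace X]
        [TopologicalSpace Y] (f : C(X, Y)) (y₀ y₁ : Y) (z₀ : Y × Y), Joined y₁ y₀ →
        (∃ x, Joined (f x) y₁) → Joined z₀.1 z₀.2 →
      S.dist f (ContinuousMap.const X y₁) = S.catMap f y₀ ∧
      S.catMap f y₀ ≤ S.TC Y ∧
      S.TC Y ≤ S.cat (Y × Y) z₀) ∧
    (∀ (X Y : Type u) [TopologicalSpace X] [TopologicalSpace Y] (f : C(X, Y)) (y₀ y₁ : Y)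
        (z₀ : Y × Y), Joined y₁ y₀ → Joined z₀.1 z₀.2 →
      UnptLift.distOp f (ContinuousMap.const X y₁) =
        UnptLift.liftcatOp f (UnptLift.pointMap y₀) ∧
      UnptLift.liftcatOp f (UnptLift.pointMap y₀) ≤ UnptLift.TCOp Y ∧
      UnptLift.TCOp Y ≤ UnptLift.catOp (Y × Y) z₀) ∧
    (∀ (S : PtSpace.SectionalCategory.{u}) (X Y : PtSpace.{u}) (f : PtSpace.Map X Y),
        X.WellPointed → Y.WellPointed →
      S.dist f (PtSpace.const X Y) = S.catMap f ∧
      S.catMap f ≤ S.TC Y ∧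
      S.TC Y ≤ S.cat (Y.prod Y)) ∧
    (∀ (X Y : PtSpace.{u}) (f : PtSpace.Map X Y),
      PtSpace.distOp f (PtSpace.const X Y) =
        PtSpace.liftcatOp f (PtSpace.const PtSpace.point Y) ∧
      PtSpace.liftcatOp f (PtSpace.const PtSpace.point Y) ≤ PtSpace.TCOp Y ∧
      PtSpace.TCOp Y ≤ PtSpace.catOp (Y.prod Y)) := by
  refine ⟨?_, ?_, ?_, ?_⟩
  · intro S X Y _ _ f y₀ y₁ z₀ hy hf hz
    have hD := S.dist_const_eq_catMap f hy
    exact ⟨hD, hD ▸ S.dist_le_TC hf, S.TC_le_cat_prod hz⟩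
  · intro X Y _ _ f y₀ y₁ z₀ hy hz
    have hD := UnptLift.distOp_const_eq_liftcatOp_pointMap f hy
    exact ⟨hD, hD ▸ UnptLift.distOp_le_TCOp f _, UnptLift.TCOp_le_catOp_prod hz⟩
  · intro S X Y f hX hY
    have hD := S.dist_const_eq_catMap hX hY f
    exact ⟨hD, hD ▸ S.dist_le_TC hX hY f _, S.TC_le_cat_prod hY⟩
  · intro X Y f
    have hD := PtSpace.distOp_const_eq_liftcatOp_const_point f
    exact ⟨hD, hD ▸ PtSpace.distOp_le_TCOp f _, PtSpace.TCOp_le_catOp_prod Y⟩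

theorem mainTheorem10 :
    -- unpointed spaces, any abstract sectional category
    (∀ (S : UnptLift.SectionalCategory.{u}) (X : Type u) [TopologicalSpace X]
        [PathConnectedSpace X] (n : C(X, X)) (_ : ∃ x₁, ∀ x, n x = x₁) (x₀ : X) (z₀ : X × X),
      S.dist (ContinuousMap.id X) n = S.cat X x₀ ∧
      S.cat X x₀ ≤ S.TC X ∧
      S.TC X ≤ S.cat (X × X) z₀) ∧
    -- unpointed spaces, the version with open covers
    (∀ (X : Type u) [TopologicalSpace X] [PathConnectedSpace X] (n : C(X, X))
        (_ : ∃ x₁, ∀ x, n x = x₁) (x₀ : X) (z₀ : X × X),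
      UnptLift.distOp (ContinuousMap.id X) n = UnptLift.catOp X x₀ ∧
      UnptLift.catOp X x₀ ≤ UnptLift.TCOp X ∧
      UnptLift.TCOp X ≤ UnptLift.catOp (X × X) z₀) ∧
    -- well-pointed spaces, any abstract sectional category
    (∀ (S : PtSpace.SectionalCategory.{u}) (X : PtSpace.{u}), X.WellPointed →
      S.dist (PtSpace.Map.id X) (PtSpace.const X X) = S.cat X ∧
      S.cat X ≤ S.TC X ∧
      S.TC X ≤ S.cat (X.prod X)) ∧
    -- well-pointed spaces, the version with open covers
    (∀ X : PtSpace.{u}, X.WellPointed →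
      PtSpace.distOp (PtSpace.Map.id X) (PtSpace.const X X) = PtSpace.catOp X ∧
      PtSpace.catOp X ≤ PtSpace.TCOp X ∧
      PtSpace.TCOp X ≤ PtSpace.catOp (X.prod X)) := by
  obtain ⟨h_unpt, h_unptOp, h_pt, h_ptOp⟩ := mainTheorem10_general
  refine ⟨fun S X _ _ n ⟨x₁, hn⟩ x₀ z₀ => ?_, fun X _ _ n ⟨x₁, hn⟩ x₀ z₀ => ?_,
    fun S X hX => h_pt S X X _ hX hX, fun X _ => h_ptOp X X _⟩ <;>
    obtain rfl : n = .const X x₁ := ContinuousMap.ext hn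
  · exact h_unpt S X X _ x₀ x₁ z₀ (PathConnectedSpace.joined ..) ⟨x₁, .refl x₁⟩
      (PathConnectedSpace.joined ..)
  · exact h_unptOp X X _ x₀ x₁ z₀ (PathConnectedSpace.joined ..) (PathConnectedSpace.joined ..)
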